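/- Encode a binary string $w = w_1\cdots w_n$, $n \ge 1$, as the first-order structure with universe $\{1,\dots,n\}$, the usual order $<$, the unary predicate $S = \{i : w_i = 1\}$, and the constants $\mathsf{min} = 1$ and $\mathsf{max} = n$. A first-order sentence $\varphi$ over $\langle <, S; \mathsf{min}, \mathsf{max}\rangle$ (with equality) defines $f : \{0,1\}^n \to \{0,1\}$ if $\varphi$ is true in the structures of all $w$ with $f(w) = 1$ and false in those of all $w$ with $f(w) = 0$. A family $(f_n)_{n\ge 1}$ of Boolean functions $f_n : \{0,1\}^n \to \{0,1\}$ is sparse if there are $C, k \in \mathbb{N}$ with $|f_n^{-1}(1)| \le C n^k$ for all $n \ge 1$. Logarithms are to base $2$. (Upper bound) For every $\varepsilon > 0$ and all $C, k \in \mathbb{N}$ there is a constant $D$, depending only on $\varepsilon$, $C$ and $k$, such that for every sparse family $(f_n)_{n\ge1}$ with $|f_n^{-1}(1)| \le C n^k$ for all $n \ge 1$, and for every $n \ge 1$, the function $f_n$ is defined by a first-order sentence with at most $(1+\varepsilon)\log n + D$ quantifiers. (Lower bound) There is a sparse family $(f_n)_{n \ge 1}$ such that, for all sufficiently large $n$,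 every first-order sentence that defines $f_n$ has at least $\lfloor \log n \rfloor$ quantifiers. -/

import Mathlib

namespace BinString

/-- The function symbols of the vocabulary of binary strings: the constants `min` and `max`. -/
inductive Func : ℕ → Type
  | min : Func 0
  | max : Func 0

/-- The relation symbols of the vocabulary of binary strings: the unary predicate `S` and the
binary predicate `<`. -/
inductive Rel : ℕ → Type
  | S : Rel 1
  | lt : Rel 2

/-- The vocabulary of binary strings (equality is part of the logic). -/
def lang : FirstOrder.Language.{0, 0} := ⟨Func, Rel⟩

/-- The structure encoding the string `w` with `n ≥ 1` bits. The universe is the set of positions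
in their usual order, `S` holds at the positions that carry a `1`, and `min`, `max` are the first
and the last position. -/
@[reducible]
def toStructure {n : ℕ} [NeZero n] (w : Fin n → Bool) : lang.Structure (Fin n) where
  funMap := fun c _ =>
    match c with
    | Func.min => ⟨0, NeZero.pos n⟩
    | Func.max => ⟨n - 1, Nat.sub_one_lt (NeZero.ne n)⟩
  RelMap := fun R =>
    match R with
    | Rel.S => fun x => w (x 0) = true
    | Rel.lt => fun x => x 0 < x 1

/-- The string `w` is a model of the sentence `φ`. -/
def Satisfies {n : ℕ} [NeZero n] (w : Fin n → Bool) (φ : lang.Sentence) : Prop :=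
  @FirstOrder.Language.Sentence.Realize lang (Fin n) (toStructure w) φ

/-- `φ` is a separating sentence for `(A, B)`. -/
def Separates {n : ℕ} [NeZero n] (φ : lang.Sentence) (A B : Set (Fin n → Bool)) : Prop :=
  (∀ w ∈ A, Satisfies w φ) ∧ (∀ w ∈ B, ¬ Satisfies w φ)

/-- `φ` defines the Boolean function `f`: it separates the `1`-inputs from the `0`-inputs. -/
def Defines {n : ℕ} [NeZero n] (φ : lang.Sentence) (f : (Fin n → Bool) → Bool) : Prop :=
  Separates φ {w | f w = true} {w | f w = false}

/-- The number of occurrences of quantifiers in a formula. The only primitive quantifier of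
`BoundedFormula` is `∀`, and `∃ x, φ` is `¬ ∀ x, ¬ φ`, which contributes one as well. -/
def quantifierNumber {L : FirstOrder.Language.{0, 0}} {α : Type} : {m : ℕ} → L.BoundedFormula α m → ℕ
  | _, .falsum => 0
  | _, .equal _ _ => 0
  | _, .rel _ _ => 0
  | _, .imp φ ψ => quantifierNumber φ + quantifierNumber ψ
  | _, .all φ => quantifierNumber φ + 1

/-- A family of Boolean functions: for every `n`, a function of `n`-bit strings. Only the members
with `n ≥ 1` are ever looked at. -/
abbrev Family : Type := (n : ℕ) → (Fin n → Bool) → Bool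

/-- For all `n ≥ 1`, at most `C * n ^ k` strings of `n` bits are mapped to `1`. -/
def Family.OnesBoundedBy (F : Family) (C k : ℕ) : Prop :=
  ∀ n : ℕ, 1 ≤ n → Nat.card {w : Fin n → Bool // F n w = true} ≤ C * n ^ k

/-- A family is sparse if it has polynomially many `1`-inputs. -/
def Family.IsSparse (F : Family) : Prop :=
  ∃ C k : ℕ, F.OnesBoundedBy C k

end BinString

namespace BinString

open FirstOrder Language

/-! Lower bound. Let `L` be the integer part of `log n`. Two strings with a single `1`, at `2 ^ (L -
1) - 1` and at `2 ^ (L - 1)` counted from 0, cannot be told apart in an Ehrenfeucht–Fraïssé game of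
`L - 1` rounds. The usual invariant `Close`, with the `1` counted as a pebble, fails at the start by
one unit of distance. It is replaced by `Wide`: the `1` is not a pebble yet, it only has to stay far
from all pebbles. `Wide.exists_insert_left` shows that each move either preserves `Wide` or lets the
`1` join the pebbles, apart from the last round, where only the atomic formulas matter.
`holds_iff_of_safe` transfers the game to formulas.

Upper bound. A string `w` is accepted iff some accepted `v` agrees with `w` at every position `p`.
Choosing `v` costs `r` quantifiers and choosing `p` another `r`, because the order type of `r`
positions encodes `r!` values, and `r!` beats any polynomial in `n` already for `r = (ε/2) log n +
O(1)` (`exists_factorial_ge`). Different choices may share one prefix, since a case distinction on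
atomic formulas is free (`Expressible.switch`). For fixed `v` and `p` it remains to locate `p`, by
bounding its distances to both ends. Each quantifier halves a distance. Halving produces two claims
about shorter distances, but one variable serves both: the side of the middle point on which it lies
tells which claim is tested (`expressible_and_of_or`, `expressible_or`). So about `log n`
quantifiers suffice. -/

/-- Truth of a formula at a tuple of positions of the string `w`. -/
def Holds {n : ℕ} [NeZero n] (w : Fin n → Bool) {m : ℕ} (φ : lang.BoundedFormula Empty m)
    (xs : Fin m → Fin n) : Prop :=
  @BoundedFormula.Realize lang (Fin n) (toStructure w) Empty m φ default xs

lemma satisfies_iff_holds {n : ℕ} [NeZero n] (w : Fin n → Bool) (φ : lang.Sentence)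
    {xs : Fin 0 → Fin n} : Satisfies w φ ↔ Holds w φ xs := by
  unfold Satisfies Sentence.Realize Formula.Realize Holds
  refine iff_of_eq ?_
  congr 1 <;> exact Subsingleton.elim _ _

/-! ### An Ehrenfeucht–Fraïssé game on strings with a single `1` -/

/-- Two signed distances agree up to the threshold `T`. -/
def Sim (T a b : ℤ) : Prop := a = b ∨ (T ≤ a ∧ T ≤ b) ∨ (a ≤ -T ∧ b ≤ -T)

/-- Corresponding pebbles have the same pairwise distances up to the threshold `2 ^ r`. -/
def Close (r : ℕ) (B : Set (ℤ × ℤ)) : Prop :=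
  ∀ e ∈ B, ∀ f ∈ B, Sim (2 ^ r) (e.1 - f.1) (e.2 - f.2)

/-- All pebbles are far away from the positions `p`, `p'`. -/
def Wide (r : ℕ) (p p' : ℤ) (B : Set (ℤ × ℤ)) : Prop :=
  Close r B ∧
  (∀ e ∈ B, (e.1 ≤ p - (2 ^ r - 1) ∧ e.2 ≤ p' - (2 ^ r - 1)) ∨
    (p + (2 ^ r - 1) ≤ e.1 ∧ p' + (2 ^ r - 1) ≤ e.2)) ∧
  ∀ e ∈ B, ∀ f ∈ B, e.1 ≤ p → p ≤ f.1 →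
    2 ^ (r + 1) - 1 ≤ f.1 - e.1 ∧ 2 ^ (r + 1) - 1 ≤ f.2 - e.2

/-- A position of the game that is won by the second player if `r` rounds are left, where the
strings have their only `1` at `p` and `p'`. -/
def Safe (p p' : ℤ) : ℕ → Set (ℤ × ℤ) → Prop
  | 0, B => Close 0 B ∧ ∀ e ∈ B, e.1 = p ↔ e.2 = p'
  | r + 1, B => Close (r + 1) (insert (p, p') B) ∨ Wide (r + 1) p p' B

lemma Sim.mono {S T a b : ℤ} (hST : S ≤ T) (h : Sim T a b) : Sim S a b := by
  unfold Sim at *; omega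

lemma Sim.neg {T a b : ℤ} (h : Sim T a b) : Sim T (-a) (-b) := by
  unfold Sim at *; omega

lemma Sim.symm {T a b : ℤ} (h : Sim T a b) : Sim T b a := by
  unfold Sim at *; omega

lemma Close.mono {r s : ℕ} (hrs : r ≤ s) {B : Set (ℤ × ℤ)} (h : Close s B) : Close r B :=
  fun e he f hf => (h e he f hf).mono (pow_le_pow_right₀ (by norm_num) hrs)

lemma Close.subset {r : ℕ} {B B' : Set (ℤ × ℤ)} (hB : B ⊆ B') (h : Close r B') : Close r B :=
  fun e he f hf => h e (hB he) f (hB hf)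

lemma Close.insert_of_forall {r : ℕ} {B : Set (ℤ × ℤ)} (h : Close r B) {e : ℤ × ℤ}
    (he : ∀ f ∈ B, Sim (2 ^ r) (e.1 - f.1) (e.2 - f.2)) : Close r (insert e B) := by
  rintro x (rfl | hx) y (rfl | hy)
  · left; simp
  · exact he y hy
  · have := (he x hx).neg
    simpa using this
  · exact h x hx y hy

/-- A pebble may be inserted between two neighbouring pebbles. -/
lemma Close.insert_between {r : ℕ} {B : Set (ℤ × ℤ)} (h : Close r B) {l u : ℤ × ℤ} {a b : ℤ}
    (hl : l ∈ B) (hu : u ∈ B) (hla : l.1 ≤ a) (hlb : l.2 ≤ b) (hau : a ≤ u.1) (hbu : b ≤ u.2)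
    (hB : ∀ e ∈ B, e.1 ≤ l.1 ∨ u.1 ≤ e.1)
    (h1 : Sim (2 ^ r) (a - l.1) (b - l.2)) (h2 : Sim (2 ^ r) (u.1 - a) (u.2 - b)) :
    Close r (insert (a, b) B) := by
  -- A distance from the new pebble to `e` is its distance to the neighbour on that side plus a
  -- distance of the same sign between old pebbles, so agreement up to the threshold adds up.
  refine h.insert_of_forall fun e he => ?_
  have hpos : (1 : ℤ) ≤ 2 ^ r := one_le_pow₀ (by norm_num)
  have hel := h l hl e he
  have heu := h e he u hu
  have := hB e he
  unfold Sim at *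
  simp only
  generalize (2 : ℤ) ^ r = T at *
  omega

lemma exists_neighbours {B : Set (ℤ × ℤ)} (hfin : B.Finite) {a : ℤ}
    (hlow : ∃ e ∈ B, e.1 ≤ a) (hup : ∃ e ∈ B, a ≤ e.1) :
    ∃ l ∈ B, ∃ u ∈ B, l.1 ≤ a ∧ a ≤ u.1 ∧ (∀ e ∈ B, e.1 ≤ a → e.1 ≤ l.1) ∧
      ∀ e ∈ B, a ≤ e.1 → u.1 ≤ e.1 := by
  obtain ⟨l, ⟨hl, hla⟩, hl'⟩ := Set.exists_max_image {e ∈ B | e.1 ≤ a} Prod.fst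
    (hfin.subset (Set.sep_subset _ _)) hlow
  obtain ⟨u, ⟨hu, hua⟩, hu'⟩ := Set.exists_min_image {e ∈ B | a ≤ e.1} Prod.fst
    (hfin.subset (Set.sep_subset _ _)) hup
  exact ⟨l, hl, u, hu, hla, hua, fun e he h => hl' e ⟨he, h⟩, fun e he h => hu' e ⟨he, h⟩⟩

/-- The response of the second player to a move between two neighbouring pebbles whose distances
agree up to twice the threshold. -/
lemma exists_response {T a l u l' u' : ℤ} (hT : 1 ≤ T) (hla : l < a) (hau : a < u)
    (h : Sim (2 * T) (u - l) (u' - l')) :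
    ∃ b, l' < b ∧ b < u' ∧ Sim T (a - l) (b - l') ∧ Sim T (u - a) (u' - b) := by
  unfold Sim at *
  -- A distance below `T` is copied exactly; the remaining part is then at least `T` on both boards
  -- or equal on both.
  by_cases h1 : a - l < T
  · exact ⟨l' + (a - l), by omega⟩
  · by_cases h2 : u - a < T
    · exact ⟨u' - (u - a), by omega⟩
    · exact ⟨l' + T, by omega⟩

lemma Close.exists_insert {r : ℕ} {B : Set (ℤ × ℤ)} (h : Close (r + 1) B) (hfin : B.Finite)
    {a : ℤ} (hlow : ∃ e ∈ B, e.1 ≤ a) (hup : ∃ e ∈ B, a ≤ e.1) :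
    ∃ b, Close r (insert (a, b) B) := by
  obtain ⟨l, hl, u, hu, hla, hau, hl', hu'⟩ := exists_neighbours hfin hlow hup
  have hr := h.mono (Nat.le_succ r)
  rcases hla.eq_or_lt with rfl | hla
  · exact ⟨l.2, by simpa [Set.insert_eq_of_mem hl] using hr⟩
  rcases hau.eq_or_lt with rfl | hau
  · exact ⟨u.2, by simpa [Set.insert_eq_of_mem hu] using hr⟩
  obtain ⟨b, hb1, hb2, hb3, hb4⟩ := exists_response (T := 2 ^ r) (one_le_pow₀ (by norm_num))
    hla hau (l' := l.2) (u' := u.2) (by rw [← pow_succ']; exact h u hu l hl)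
  refine ⟨b, hr.insert_between hl hu hla.le hb1.le hau.le hb2.le (fun e he => ?_) hb3 hb4⟩
  rcases le_total e.1 a with hea | hea
  · exact Or.inl (hl' e he hea)
  · exact Or.inr (hu' e he hea)

/-- Pebbles at distance at least `2 ^ (r + 1) - 1 ≥ 2 ^ r` from the `1` are beyond the threshold of
the next round. -/
lemma Wide.close_insert {r : ℕ} {p p' : ℤ} {B : Set (ℤ × ℤ)} (h : Wide (r + 1) p p' B) :
    Close r (insert (p, p') B) := by
  refine (h.1.mono (Nat.le_succ r)).insert_of_forall fun e he => ?_
  have hpos : (1 : ℤ) ≤ 2 ^ r := one_le_pow₀ (by norm_num)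
  have := h.2.1 e he
  rw [pow_succ] at this
  unfold Sim
  simp only
  omega

lemma Close.safe {r : ℕ} {p p' : ℤ} {B : Set (ℤ × ℤ)} (h : Close r (insert (p, p') B)) :
    Safe p p' r B := by
  cases r with
  | zero =>
    refine ⟨h.subset (Set.subset_insert _ _), fun e he => ?_⟩
    have := h e (Set.mem_insert_of_mem _ he) (p, p') (Set.mem_insert _ _)
    simp only [Sim, pow_zero] at this
    omega
  | succ r => exact Or.inl h

/-- A position that is won by the second player remains so with one round less. -/
lemma Safe.pred {r : ℕ} {p p' : ℤ} {B : Set (ℤ × ℤ)} (h : Safe p p' (r + 1) B) :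
    Safe p p' r B := by
  rcases h with h | h
  · exact (h.mono (Nat.le_succ r)).safe
  · exact h.close_insert.safe

lemma Safe.zero {r : ℕ} {p p' : ℤ} {B : Set (ℤ × ℤ)} (h : Safe p p' r B) : Safe p p' 0 B := by
  induction r with
  | zero => exact h
  | succ r ih => exact ih h.pred

/-- The second player survives a move to the left of the `1`. -/
lemma Wide.exists_insert_left {r : ℕ} {p p' : ℤ} {B : Set (ℤ × ℤ)} (h : Wide (r + 1) p p' B)
    (hfin : B.Finite) {a : ℤ} (hap : a < p) (hlow : ∃ e ∈ B, e.1 ≤ a) (hup : ∃ e ∈ B, p ≤ e.1) :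
    ∃ b, Safe p p' r (insert (a, b) B) := by
  have hpos : (1 : ℤ) ≤ 2 ^ r := one_le_pow₀ (by norm_num)
  have hr1 : (2 : ℤ) ^ (r + 1) = 2 * 2 ^ r := pow_succ' _ _
  have hr2 : (2 : ℤ) ^ (r + 1 + 1) = 4 * 2 ^ r := by ring
  have hclose := h.close_insert
  obtain ⟨hB, hside, hgap⟩ := h
  rw [hr1] at hside
  rw [hr2] at hgap
  obtain ⟨l, hl, u, hu, hla, hau, hl', hu'⟩ := exists_neighbours hfin hlow
    (hup.imp fun e he => ⟨he.1, hap.le.trans he.2⟩)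
  rcases hla.eq_or_lt with rfl | hla
  · exact ⟨l.2, by simpa [Set.insert_eq_of_mem hl] using hclose.safe⟩
  rcases hau.eq_or_lt with rfl | hau
  · exact ⟨u.2, by simpa [Set.insert_eq_of_mem hu] using hclose.safe⟩
  have hnb : ∀ e ∈ B, e.1 ≤ l.1 ∨ u.1 ≤ e.1 := fun e he =>
    (le_total e.1 a).imp (hl' e he) (hu' e he)
  have hrB : Close r B := hB.mono (Nat.le_succ r)
  have hls := hside l hl
  have hus := hside u hu
  rcases lt_or_ge u.1 p with hup' | hup'
  · obtain ⟨b, hb1, hb2, hb3, hb4⟩ := exists_response (T := 2 ^ r) hpos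
      hla hau (l' := l.2) (u' := u.2) (by rw [← pow_succ']; exact hB u hu l hl)
    refine ⟨b, ?_⟩
    have hc := hrB.insert_between hl hu hla.le hb1.le hau.le hb2.le hnb hb3 hb4
    refine Close.safe ?_
    rw [Set.insert_comm]
    refine hclose.insert_between (Set.mem_insert_of_mem _ hl) (Set.mem_insert_of_mem _ hu)
      hla.le hb1.le hau.le hb2.le ?_ hb3 hb4
    rintro e (rfl | he)
    · exact Or.inr hup'.le
    · exact hnb e he
  have hlu := hgap l hl u hu (by omega) hup'
  -- From here on the move falls into the gap between `l` and `u` that contains the `1`.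
  have hnb' : ∀ e ∈ insert (p, p') B, e.1 ≤ l.1 ∨ p ≤ e.1 := by
    rintro e (rfl | he)
    · exact Or.inr le_rfl
    · exact (hnb e he).imp id fun h => hup'.trans h
  have key : ∀ b, l.2 ≤ b → b ≤ p' → Sim (2 ^ r) (a - l.1) (b - l.2) →
      Sim (2 ^ r) (p - a) (p' - b) → Safe p p' r (insert (a, b) B) := by
    intro b hb1 hb2 hb3 hb4
    refine Close.safe ?_
    rw [Set.insert_comm]
    exact hclose.insert_between (Set.mem_insert_of_mem _ hl) (Set.mem_insert _ _) hla.le hb1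
      hap.le hb2 hnb' hb3 hb4
  by_cases ht : a - l.1 < 2 ^ r
  · refine ⟨l.2 + (a - l.1), key _ ?_ ?_ ?_ ?_⟩ <;> (try unfold Sim) <;> omega
  by_cases hs : p - a < 2 ^ r
  · refine ⟨p' - (p - a), key _ ?_ ?_ ?_ ?_⟩ <;> (try unfold Sim) <;> omega
  -- The move is now at least `2 ^ r` away from both `l` and the `1`. On the other board the `1` may
  -- be only `2 ^ (r + 1) - 1` away from `l`, so the reply may end up at distance `2 ^ r - 1` from
  -- it. This is exactly what `Wide` tolerates.
  have ins : ∀ b, l.2 + 2 ^ r ≤ b → b + 2 ^ r ≤ u.2 → Close r (insert (a, b) B) := by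
    intro b hb1 hb2
    refine hrB.insert_between hl hu hla.le (by omega) hau.le (by omega) hnb ?_ ?_ <;>
      unfold Sim <;> omega
  cases r with
  | zero =>
    -- In the last round only the order and avoiding the `1` matter; if the `1` directly follows
    -- `l`, the reply may lie behind it.
    by_cases hb : l.2 + 1 < p'
    · refine ⟨l.2 + 1, ins _ (by simp) (by simp at *; omega), ?_⟩
      rintro e (rfl | he)
      · simp only; omega
      · have := hside e he
        simp only [pow_zero] at this
        omega
    · refine ⟨p' + 1, ins _ (by simp at *; omega) (by simp at *; omega), ?_⟩
      rintro e (rfl | he)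
      · simp only; omega
      · have := hside e he
        simp only [pow_zero] at this
        omega
  | succ r =>
    refine ⟨l.2 + 2 ^ (r + 1), Or.inr ⟨ins _ le_rfl (by omega), ?_, ?_⟩⟩
    · rintro e (rfl | he)
      · simp only; omega
      · have := hside e he
        omega
    · rw [hr1]
      have hpos' : (2 : ℤ) ≤ 2 ^ (r + 1) := by
        rw [pow_succ]; have : (1 : ℤ) ≤ 2 ^ r := one_le_pow₀ (by norm_num)
        omega
      rintro e (rfl | he) f (rfl | hf) hep hpf
      · simp only at *; omega
      · have := hside f hf
        simp only at *; omega
      · simp only at *; omega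
      · have := hgap e he f hf hep hpf
        omega

/-- Reflection of a set of pebble pairs. -/
def reflect (B : Set (ℤ × ℤ)) : Set (ℤ × ℤ) := {e | (-e.1, -e.2) ∈ B}

lemma reflect_insert (a b : ℤ) (B : Set (ℤ × ℤ)) :
    reflect (insert (a, b) B) = insert (-a, -b) (reflect B) := by
  ext ⟨x, y⟩
  simp [reflect, neg_eq_iff_eq_neg]

lemma reflect_reflect (B : Set (ℤ × ℤ)) : reflect (reflect B) = B := by
  ext ⟨x, y⟩
  simp [reflect]

lemma Close.reflect {r : ℕ} {B : Set (ℤ × ℤ)} (h : Close r B) : Close r (reflect B) := by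
  intro e he f hf
  have := h _ hf _ he
  simpa [neg_add_eq_sub] using this

lemma Wide.reflect {r : ℕ} {p p' : ℤ} {B : Set (ℤ × ℤ)} (h : Wide r p p' B) :
    Wide r (-p) (-p') (reflect B) := by
  refine ⟨h.1.reflect, fun e he => ?_, fun e he f hf h1 h2 => ?_⟩
  · have := h.2.1 _ he
    simp only at this
    omega
  · have := h.2.2 _ hf _ he (by simp only; omega) (by simp only; omega)
    simp only at this
    omega

lemma Safe.reflect {r : ℕ} {p p' : ℤ} {B : Set (ℤ × ℤ)} (h : Safe p p' r B) :
    Safe (-p) (-p') r (reflect B) := by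
  cases r with
  | zero =>
    refine ⟨h.1.reflect, fun e he => ?_⟩
    have := h.2 _ he
    simp only at this
    omega
  | succ r =>
    rcases h with h | h
    · left
      rw [← reflect_insert]
      exact h.reflect
    · exact Or.inr h.reflect

/-- Exchange of the two strings. -/
lemma Safe.swap {r : ℕ} {p p' : ℤ} {B : Set (ℤ × ℤ)} (h : Safe p p' r B) :
    Safe p' p r (Prod.swap ⁻¹' B) := by
  have hc : ∀ {s : ℕ} {B : Set (ℤ × ℤ)}, Close s B → Close s (Prod.swap ⁻¹' B) :=
    fun h e he f hf => (h _ he _ hf).symm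
  cases r with
  | zero => exact ⟨hc h.1, fun e he => (h.2 _ he).symm⟩
  | succ r =>
    rcases h with h | h
    · left
      have : insert (p', p) (Prod.swap ⁻¹' B) = Prod.swap ⁻¹' (insert (p, p') B) := by
        ext ⟨x, y⟩
        simp [and_comm]
      rw [this]
      exact hc h
    · have hpos : (2 : ℤ) ≤ 2 ^ (r + 1) := by
        rw [pow_succ]; have : (1 : ℤ) ≤ 2 ^ r := one_le_pow₀ (by norm_num)
        omega
      refine Or.inr ⟨hc h.1, fun e he => ?_, fun e he f hf h1 h2 => ?_⟩
      · have := h.2.1 _ he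
        simp only [Prod.fst_swap, Prod.snd_swap] at this
        omega
      · have he' := h.2.1 _ he
        have hf' := h.2.1 _ hf
        have := h.2.2 _ he _ hf
        simp only [Prod.fst_swap, Prod.snd_swap] at *
        omega

/-- The second player survives every move. -/
lemma Safe.exists_insert {r : ℕ} {p p' : ℤ} {B : Set (ℤ × ℤ)} (h : Safe p p' (r + 1) B)
    (hfin : B.Finite) {a : ℤ} (hlow : ∃ e ∈ B, e.1 ≤ a ∧ e.1 ≤ p)
    (hup : ∃ e ∈ B, a ≤ e.1 ∧ p ≤ e.1) : ∃ b, Safe p p' r (insert (a, b) B) := by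
  rcases h with h | h
  · obtain ⟨b, hb⟩ := h.exists_insert (hfin.insert _)
      (hlow.imp fun e he => ⟨Set.mem_insert_of_mem _ he.1, he.2.1⟩)
      (hup.imp fun e he => ⟨Set.mem_insert_of_mem _ he.1, he.2.1⟩)
    rw [Set.insert_comm] at hb
    exact ⟨b, hb.safe⟩
  rcases lt_trichotomy a p with hap | rfl | hap
  · exact h.exists_insert_left hfin hap (hlow.imp fun e he => ⟨he.1, he.2.1⟩)
      (hup.imp fun e he => ⟨he.1, he.2.2⟩)
  · refine ⟨p', Close.safe ?_⟩
    simpa using h.close_insert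
  · obtain ⟨e, he, hea, hep⟩ := hlow
    obtain ⟨f, hf, hfa, hfp⟩ := hup
    have hfin' : (BinString.reflect B).Finite :=
      hfin.preimage (f := fun e : ℤ × ℤ => (-e.1, -e.2)) (fun x _ y _ hxy => by
        simpa [Prod.ext_iff] using hxy)
    obtain ⟨b, hb⟩ := h.reflect.exists_insert_left hfin' (neg_lt_neg hap)
      ⟨-f, by simpa [BinString.reflect] using hf, by simpa using hfa⟩
      ⟨-e, by simpa [BinString.reflect] using he, by simpa using hep⟩
    refine ⟨-b, ?_⟩
    have := hb.reflect
    rw [reflect_insert, reflect_reflect] at this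
    simpa using this

/-! ### From the game to formulas -/

/-- The string of length `n` whose only `1` is at the position `p`. -/
def single (n p : ℕ) : Fin n → Bool := fun i => decide ((i : ℕ) = p)

/-- The pebbles that are on the board after the positions `xs` and `ys` have been chosen; the
constants count as pebbles. -/
def board {n m : ℕ} (xs ys : Fin m → Fin n) : Set (ℤ × ℤ) :=
  insert (0, 0) (insert ((n : ℤ) - 1, (n : ℤ) - 1)
    (Set.range fun i => (((xs i : ℕ) : ℤ), ((ys i : ℕ) : ℤ))))

lemma board_finite {n m : ℕ} (xs ys : Fin m → Fin n) : (board xs ys).Finite :=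
  ((Set.finite_range _).insert _).insert _

lemma board_snoc {n m : ℕ} (xs ys : Fin m → Fin n) (a b : Fin n) :
    board (Fin.snoc xs a : Fin (m + 1) → Fin n) (Fin.snoc ys b : Fin (m + 1) → Fin n) =
      insert (((a : ℕ) : ℤ), ((b : ℕ) : ℤ)) (board xs ys) := by
  ext e
  simp only [board, Set.mem_insert_iff, Set.mem_range, Fin.exists_fin_succ', Fin.snoc_castSucc,
    Fin.snoc_last]
  tauto

lemma board_swap {n m : ℕ} (xs ys : Fin m → Fin n) :
    Prod.swap ⁻¹' board xs ys = board ys xs := by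
  ext ⟨x, y⟩
  simp [board, and_comm]

lemma term_mem_board {n m : ℕ} [NeZero n] (w w' : Fin n → Bool) (xs ys : Fin m → Fin n)
    (t : lang.Term (Empty ⊕ Fin m)) :
    ((((@Term.realize lang (Fin n) (toStructure w) _ (Sum.elim default xs) t : Fin n) : ℕ) : ℤ),
      (((@Term.realize lang (Fin n) (toStructure w') _ (Sum.elim default ys) t : Fin n) : ℕ) : ℤ))
      ∈ board xs ys := by
  have hn : 1 ≤ n := NeZero.one_le
  cases t with
  | var v =>
    rcases v with v | i
    · exact v.elim
    · exact Or.inr (Or.inr ⟨i, rfl⟩)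
  | func f ts =>
    cases f with
    | min => left; simp [Term.realize]
    | max =>
      right; left
      change (((n - 1 : ℕ) : ℤ), ((n - 1 : ℕ) : ℤ)) = _
      rw [Nat.cast_sub hn, Nat.cast_one]

lemma holds_move {n m r : ℕ} {p p' : ℕ} (hp : p < n)
    {xs ys : Fin m → Fin n} (h : Safe p p' (r + 1) (board xs ys)) (a : Fin n) :
    ∃ b : Fin n, Safe p p' r (board (Fin.snoc xs a : Fin (m + 1) → Fin n)
      (Fin.snoc ys b : Fin (m + 1) → Fin n)) := by
  have ha := a.2
  obtain ⟨b, hb⟩ := h.exists_insert (a := ((a : ℕ) : ℤ)) (board_finite xs ys)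
    ⟨(0, 0), Or.inl rfl, by simp, by simp⟩
    ⟨((n : ℤ) - 1, (n : ℤ) - 1), Or.inr (Or.inl rfl), by simp only; omega, by simp only; omega⟩
  -- The reply is an arbitrary integer; comparison with the pebbles on the two constants confines it
  -- to the universe.
  have h0 := hb.zero.1
  have h1 := h0 _ (Set.mem_insert _ _) (0, 0) (Or.inr (Or.inl rfl))
  have h2 := h0 _ (Set.mem_insert _ _) ((n : ℤ) - 1, (n : ℤ) - 1) (Or.inr (Or.inr (Or.inl rfl)))
  simp only [Sim, pow_zero] at h1 h2
  lift b to ℕ using by omega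
  refine ⟨⟨b, by omega⟩, ?_⟩
  rw [board_snoc]
  exact hb

/-- Only nested quantifiers use up rounds: both sides of an implication are played with the full
`r`. For a quantifier, one direction answers moves in the first string, and `Safe.swap` gives the
other. -/
lemma holds_iff_of_safe {n : ℕ} [NeZero n] {p p' : ℕ} (hp : p < n) (hp' : p' < n) {m : ℕ}
    (φ : lang.BoundedFormula Empty m) : ∀ (r : ℕ) (_ : quantifierNumber φ ≤ r)
    (xs ys : Fin m → Fin n) (_ : Safe p p' r (board xs ys)),
    (Holds (single n p) φ xs ↔ Holds (single n p') φ ys) := by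
  induction φ with
  | falsum => intros; rfl
  | equal t s =>
    intro r _ xs ys h
    have := h.zero.1 _ (term_mem_board (single n p) (single n p') xs ys t)
      _ (term_mem_board (single n p) (single n p') xs ys s)
    simp only [Sim, pow_zero] at this
    simp only [Holds, BoundedFormula.Realize, Fin.ext_iff]
    omega
  | rel R ts =>
    intro r _ xs ys h
    cases R with
    | S =>
      have := h.zero.2 _ (term_mem_board (single n p) (single n p') xs ys (ts 0))
      simp only [Holds, BoundedFormula.Realize, Structure.RelMap, single, decide_eq_true_eq]
      simpa only [Nat.cast_inj] using this
    | lt =>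
      have := h.zero.1 _ (term_mem_board (single n p) (single n p') xs ys (ts 0))
        _ (term_mem_board (single n p) (single n p') xs ys (ts 1))
      simp only [Sim, pow_zero] at this
      simp only [Holds, BoundedFormula.Realize, Structure.RelMap, Fin.lt_def]
      omega
  | imp φ ψ ihφ ihψ =>
    intro r hr xs ys h
    simp only [quantifierNumber] at hr
    exact imp_congr (ihφ r (by omega) xs ys h) (ihψ r (by omega) xs ys h)
  | all φ ih =>
    intro r hr xs ys h
    simp only [quantifierNumber] at hr
    obtain ⟨r, rfl⟩ : ∃ s, r = s + 1 := ⟨r - 1, by omega⟩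
    constructor
    · intro hx b
      have h' := h.swap
      rw [board_swap] at h'
      obtain ⟨a, ha⟩ := holds_move hp' h' b
      have ha' := ha.swap
      rw [board_swap] at ha'
      exact (ih r (by omega) _ _ ha').1 (hx a)
    · intro hy a
      obtain ⟨b, hb⟩ := holds_move hp h a
      exact (ih r (by omega) _ _ hb).2 (hy b)

/-! ### The sparse family for the lower bound -/

/-- The function whose only `1`-input has its `1` next to the middle. -/
def middleFamily : Family := fun n w => decide (w = single n (2 ^ (Nat.log 2 n - 1) - 1))

lemma middleFamily_isSparse : middleFamily.IsSparse := by
  refine ⟨1, 0, fun n _ => ?_⟩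
  have : Subsingleton {w : Fin n → Bool // middleFamily n w = true} :=
    ⟨fun a b => Subtype.ext ((of_decide_eq_true a.2).trans (of_decide_eq_true b.2).symm)⟩
  simpa using Finite.card_le_one_iff_subsingleton.2 this

theorem log_le_quantifierNumber (n : ℕ) [NeZero n] (hn : 4 ≤ n) (φ : lang.Sentence)
    (hφ : Defines φ (middleFamily n)) : Nat.log 2 n ≤ quantifierNumber φ := by
  by_contra! hlt
  have hlog : 2 ≤ Nat.log 2 n := Nat.le_log_of_pow_le (by norm_num) (by simpa using hn)
  have hpow : 2 ^ Nat.log 2 n ≤ n := Nat.pow_log_le_self 2 (by omega)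
  obtain ⟨r, hr⟩ : ∃ r, Nat.log 2 n = r + 2 := ⟨_, (Nat.sub_add_cancel hlog).symm⟩
  rw [hr] at hpow hlt
  have hr1 : r + 2 - 1 = r + 1 := rfl
  have hpos : 1 ≤ 2 ^ r := Nat.one_le_two_pow
  rw [pow_add] at hpow
  have e1 : 2 ^ (r + 1) = 2 * 2 ^ r := pow_succ' _ _
  have hlt1 : 2 ^ (r + 1) - 1 < n := by omega
  have hlt2 : 2 ^ (r + 1) < n := by omega
  -- The end points satisfy `Wide (r + 1)` with no slack when `n = 2 ^ (r + 2)`: the first `1` has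
  -- distance exactly `2 ^ (r + 1) - 1` from the left end, the second from the right end.
  have hsafe : Safe ((2 ^ (r + 1) - 1 : ℕ) : ℤ) ((2 ^ (r + 1) : ℕ) : ℤ) (r + 1)
      (board (default : Fin 0 → Fin n) default) := by
    right
    zify at hpow
    have e1' : (2 : ℤ) ^ (r + 1) = 2 * 2 ^ r := pow_succ' _ _
    have e2' : (2 : ℤ) ^ (r + 1 + 1) = 4 * 2 ^ r := by ring
    have hpos' : (1 : ℤ) ≤ 2 ^ r := one_le_pow₀ (by norm_num)
    have c1 : ((2 ^ (r + 1) - 1 : ℕ) : ℤ) = 2 * 2 ^ r - 1 := by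
      rw [Nat.cast_sub (Nat.one_le_two_pow)]; push_cast; omega
    have c2 : ((2 ^ (r + 1) : ℕ) : ℤ) = 2 * 2 ^ r := by push_cast; omega
    rw [c1, c2]
    have hmem : ∀ e ∈ board (default : Fin 0 → Fin n) default,
        e = (0, 0) ∨ e = ((n : ℤ) - 1, (n : ℤ) - 1) := by
      rintro e (he | he | ⟨i, -⟩)
      · exact Or.inl he
      · exact Or.inr he
      · exact i.elim0
    refine ⟨fun e he f hf => ?_, fun e he => ?_, fun e he f hf => ?_⟩
    · left
      rcases hmem e he with rfl | rfl <;> rcases hmem f hf with rfl | rfl <;> rfl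
    · rw [e1']
      rcases hmem e he with rfl | rfl <;> simp only <;> omega
    · rw [e2']
      rcases hmem e he with rfl | rfl <;> rcases hmem f hf with rfl | rfl <;> simp only <;> omega
  have key := holds_iff_of_safe hlt1 hlt2 φ (r + 1) (by omega) _ _ hsafe
  have h1 : Satisfies (single n (2 ^ (r + 1) - 1)) φ :=
    hφ.1 _ (by simp [middleFamily, hr])
  refine hφ.2 (single n (2 ^ (r + 1))) ?_
    ((satisfies_iff_holds _ _).2 (key.1 ((satisfies_iff_holds _ _).1 h1)))
  simp only [middleFamily, hr, Set.mem_ofPred_eq, decide_eq_false_iff_not, hr1]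
  intro heq
  have := congrFun heq ⟨2 ^ (r + 1), hlt2⟩
  simp only [single, decide_true] at this
  have := of_decide_eq_true this.symm
  omega

/-! ### Predicates that are expressible with a given quantifier prefix -/

/-- A property of a string and a tuple of positions. -/
abbrev Pred (n m : ℕ) : Type := (Fin n → Bool) → (Fin m → Fin n) → Prop

section Expressible

variable {n : ℕ} {m : ℕ}

/-- The tuples `xs` and `ys` satisfy the same atomic formulas. -/
def AtomEquiv (w w' : Fin n → Bool) (xs ys : Fin m → Fin n) : Prop :=
  (∀ i j, xs i < xs j ↔ ys i < ys j) ∧ (∀ i, w (xs i) = true ↔ w' (ys i) = true) ∧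
  (∀ i, (xs i : ℕ) = 0 ↔ (ys i : ℕ) = 0) ∧ ∀ i, (xs i : ℕ) = n - 1 ↔ (ys i : ℕ) = n - 1

/-- A property that depends on nothing but atomic formulas. -/
def IsAtomic (P : Pred n m) : Prop :=
  ∀ w w' xs ys, AtomEquiv w w' xs ys → (P w xs ↔ P w' ys)

/-- The property `P` is expressible with the quantifier prefix `qs`, where `true` stands for `∃`
and `false` for `∀`. -/
def Expressible : List Bool → {m : ℕ} → Pred n m → Prop
  | [], _, P => IsAtomic P
  | true :: qs, m, P => ∃ P' : Pred n (m + 1), Expressible qs P' ∧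
      ∀ w xs, P w xs ↔ ∃ a, P' w (Fin.snoc xs a)
  | false :: qs, m, P => ∃ P' : Pred n (m + 1), Expressible qs P' ∧
      ∀ w xs, P w xs ↔ ∀ a, P' w (Fin.snoc xs a)

lemma Expressible.congr {qs : List Bool} {P Q : Pred n m} (h : Expressible qs P)
    (hPQ : ∀ w xs, Q w xs ↔ P w xs) : Expressible qs Q := by
  have : Q = P := by
    funext w xs
    exact propext (hPQ w xs)
  rwa [this]

lemma AtomEquiv.comp {m' : ℕ} {w w' : Fin n → Bool} {xs ys : Fin m' → Fin n}
    (h : AtomEquiv w w' xs ys) (f : Fin m → Fin m') : AtomEquiv w w' (xs ∘ f) (ys ∘ f) :=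
  ⟨fun i j => h.1 (f i) (f j), fun i => h.2.1 (f i), fun i => h.2.2.1 (f i),
    fun i => h.2.2.2 (f i)⟩

lemma IsAtomic.comp {P : Pred n m} (h : IsAtomic P) {m' : ℕ} (f : Fin m → Fin m') :
    IsAtomic (fun w (xs : Fin m' → Fin n) => P w (xs ∘ f)) :=
  fun w w' _ _ hxy => h w w' _ _ (hxy.comp f)

lemma isAtomic_le (i j : Fin m) : IsAtomic (fun _ (xs : Fin m → Fin n) => xs i ≤ xs j) := by
  intro w w' xs ys h
  simp only [← not_lt, h.1 j i]

lemma IsAtomic.not {P : Pred n m} (h : IsAtomic P) : IsAtomic (fun w xs => ¬ P w xs) :=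
  fun w w' xs ys hxy => not_congr (h w w' xs ys hxy)

lemma IsAtomic.or {P Q : Pred n m} (h : IsAtomic P) (h' : IsAtomic Q) :
    IsAtomic (fun w xs => P w xs ∨ Q w xs) :=
  fun w w' xs ys hxy => or_congr (h w w' xs ys hxy) (h' w w' xs ys hxy)

lemma isAtomic_const (p : Prop) : IsAtomic (fun _ (_ : Fin m → Fin n) => p) :=
  fun _ _ _ _ _ => Iff.rfl

lemma snoc_comp_castSucc (xs : Fin m → Fin n) (a : Fin n) :
    (Fin.snoc xs a : Fin (m + 1) → Fin n) ∘ Fin.castSucc = xs := by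
  funext i
  simp

/-- Substitution of variables. -/
lemma Expressible.comp {qs : List Bool} : ∀ {m m' : ℕ} {P : Pred n m} (_ : Expressible qs P)
    (f : Fin m → Fin m'), Expressible qs (fun w (xs : Fin m' → Fin n) => P w (xs ∘ f)) := by
  induction qs with
  | nil => exact fun h f => IsAtomic.comp h f
  | cons q qs ih =>
    intro m m' P h f
    have hsn : ∀ (xs : Fin m' → Fin n) (a : Fin n),
        (Fin.snoc (xs ∘ f) a : Fin (m + 1) → Fin n) = (Fin.snoc xs a : Fin (m' + 1) → Fin n) ∘
          (Fin.snoc (Fin.castSucc ∘ f) (Fin.last m') : Fin (m + 1) → Fin (m' + 1)) := by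
      intro xs a
      funext i
      induction i using Fin.lastCases <;> simp
    cases q <;>
    · obtain ⟨P', hP', hP⟩ := h
      refine ⟨_, ih hP' (Fin.snoc (Fin.castSucc ∘ f) (Fin.last m')), fun w xs => ?_⟩
      simp only [hP, hsn]

lemma IsAtomic.expressible [NeZero n] {qs : List Bool} :
    ∀ {m : ℕ} {P : Pred n m} (_ : IsAtomic P), Expressible qs P := by
  induction qs with
  | nil => exact fun h => h
  | cons q qs ih =>
    intro m P h
    cases q <;>
    · refine ⟨_, ih (h.comp Fin.castSucc), fun w xs => ?_⟩
      simp only [snoc_comp_castSucc, exists_const, forall_const]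

lemma Expressible.not {qs : List Bool} : ∀ {m : ℕ} {P : Pred n m} (_ : Expressible qs P),
    Expressible (qs.map Bool.not) (fun w xs => ¬ P w xs) := by
  induction qs with
  | nil => exact fun h => IsAtomic.not h
  | cons q qs ih =>
    intro m P h
    cases q <;>
    · obtain ⟨P', hP', hP⟩ := h
      refine ⟨_, ih hP', fun w xs => ?_⟩
      simp only [hP, not_forall, not_exists]

/-- Properties with the same prefix are combined by a case distinction on atomic formulas. -/
lemma Expressible.switch [NeZero n] {qs : List Bool} {ι : Type*} :
    ∀ {m : ℕ} {θ P : ι → Pred n m} (_ : ∀ i, IsAtomic (θ i))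
    (_ : ∀ w xs i j, θ i w xs → θ j w xs → i = j) (_ : ∀ i, Expressible qs (P i)),
    Expressible qs (fun w xs => ∃ i, θ i w xs ∧ P i w xs) := by
  induction qs with
  | nil =>
    exact fun hθ _ hP w w' xs ys hxy =>
      exists_congr fun i => and_congr (hθ i w w' xs ys hxy) (hP i w w' xs ys hxy)
  | cons q qs ih =>
    intro m θ P hθ hdis hP
    cases q
    all_goals
      choose P' hP' hPP' using hP
      refine ⟨_, ih (θ := fun i w xs => θ i w (xs ∘ Fin.castSucc)) (P := P')
        (fun i => (hθ i).comp _) (fun w xs => hdis w _) hP', fun w xs => ?_⟩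
      simp only [hPP', snoc_comp_castSucc]
    · constructor
      · rintro ⟨i, hi, h⟩ a
        exact ⟨i, hi, h a⟩
      · intro h
        -- The guards do not involve the quantified position and exclude each other, so the index
        -- found at one position serves all of them.
        obtain ⟨i, hi, -⟩ := h 0
        refine ⟨i, hi, fun a => ?_⟩
        obtain ⟨j, hj, hja⟩ := h a
        rwa [hdis _ _ i j hi hj]
    · constructor
      · rintro ⟨i, hi, a, h⟩
        exact ⟨a, i, hi, h⟩
      · rintro ⟨a, i, hi, h⟩
        exact ⟨i, hi, a, h⟩

lemma Expressible.cases [NeZero n] {qs : List Bool} {θ P Q : Pred n m} (hθ : IsAtomic θ)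
    (hP : Expressible qs P) (hQ : Expressible qs Q) :
    Expressible qs (fun w xs => (θ w xs ∧ P w xs) ∨ (¬ θ w xs ∧ Q w xs)) := by
  refine (Expressible.switch (ι := Bool) (θ := fun b w xs => if b then θ w xs else ¬ θ w xs)
    (P := fun b => if b then P else Q) ?_ ?_ ?_).congr ?_
  · rintro (_ | _)
    · simpa using hθ.not
    · simpa using hθ
  · rintro w xs (_ | _) (_ | _) <;> simp +contextual
  · rintro (_ | _) <;> simpa
  · intro w xs
    simp [or_comm]

lemma Expressible.and_atomic [NeZero n] {qs : List Bool} {θ P : Pred n m} (hθ : IsAtomic θ)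
    (hP : Expressible qs P) : Expressible qs (fun w xs => θ w xs ∧ P w xs) :=
  (hP.cases hθ (isAtomic_const False).expressible).congr fun w xs => by simp

/-! ### Guessing an index through an order type -/

/-- A block of existential quantifiers. -/
lemma Expressible.exists_block : ∀ {m : ℕ} {qs : List Bool} {P : Pred n m}
    (_ : Expressible qs P), Expressible (List.replicate m true ++ qs)
      (fun w (_ : Fin 0 → Fin n) => ∃ ys, P w ys) := by
  intro m
  induction m with
  | zero =>
    intro qs P h
    refine Expressible.congr (by simpa using h) fun w xs => ?_
    exact ⟨fun ⟨ys, hy⟩ => by rwa [Subsingleton.elim xs ys], fun hx => ⟨xs, hx⟩⟩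
  | succ m ih =>
    intro qs P h
    have h' : Expressible (true :: qs)
        (fun w (xs : Fin m → Fin n) => ∃ a, P w (Fin.snoc xs a)) := ⟨P, h, fun _ _ => Iff.rfl⟩
    rw [List.replicate_succ', List.append_assoc]
    refine (ih h').congr fun w _ => ?_
    constructor
    · rintro ⟨ys, hy⟩
      exact ⟨Fin.init ys, ys (Fin.last m), by rwa [Fin.snoc_init_self]⟩
    · rintro ⟨ys, a, hy⟩
      exact ⟨_, hy⟩

lemma perm_eq_of_strictMono {r : ℕ} {α : Type*} [LinearOrder α] {ys : Fin r → α}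
    {σ τ : Equiv.Perm (Fin r)} (hσ : StrictMono (ys ∘ σ)) (hτ : StrictMono (ys ∘ τ)) : σ = τ := by
  have h := Tuple.unique_monotone hσ.monotone hτ.monotone
  have hinj : Function.Injective ys := by
    have := hσ.injective.comp σ.symm.injective
    simpa [Function.comp_assoc] using this
  ext i
  exact congrArg Fin.val (hinj (congrFun h i))

/-- An index is guessed by existential quantifiers: their order type encodes it. -/
lemma Expressible.exists_index [NeZero n] {ι : Type*} {r : ℕ} (hr : r ≤ n)
    (e : ι ↪ Equiv.Perm (Fin r)) {qs : List Bool} {P : ι → Pred n 0}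
    (hP : ∀ i, Expressible qs (P i)) :
    Expressible (List.replicate r true ++ qs) (fun w xs => ∃ i, P i w xs) := by
  refine (Expressible.exists_block (m := r) (Expressible.switch
    (θ := fun i _ ys => StrictMono (ys ∘ e i)) (P := fun i w ys => P i w (ys ∘ Fin.elim0))
    ?_ ?_ fun i => (hP i).comp _)).congr fun w xs => ?_
  · intro i w w' xs ys h
    simp only [StrictMono, Function.comp_apply, h.1]
  · intro w xs i j hi hj
    exact e.injective (perm_eq_of_strictMono hi hj)
  · constructor
    · rintro ⟨i, hi⟩
      -- The first `r` positions, permuted so that their order type encodes `i`.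
      refine ⟨Fin.castLE hr ∘ (e i).symm, i, ?_, ?_⟩
      · simpa [Function.comp_assoc] using Fin.strictMono_castLE hr
      · rwa [Subsingleton.elim (_ ∘ _) xs]
    · rintro ⟨ys, i, -, hi⟩
      exact ⟨i, by rwa [Subsingleton.elim xs]⟩

lemma Expressible.forall_index [NeZero n] {ι : Type*} {r : ℕ} (hr : r ≤ n)
    (e : ι ↪ Equiv.Perm (Fin r)) {qs : List Bool} {P : ι → Pred n 0}
    (hP : ∀ i, Expressible qs (P i)) :
    Expressible (List.replicate r false ++ qs) (fun w xs => ∀ i, P i w xs) := by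
  have := (Expressible.exists_index hr e fun i => (hP i).not).not
  simp only [List.map_append, List.map_replicate, Bool.not_true, List.map_map,
    Function.Involutive.comp_self Bool.not_not, List.map_id] at this
  exact this.congr fun w xs => by simp

/-! ### Distances -/

/-- The prefix `(∃∀)^j`. -/
def alternating : ℕ → List Bool
  | 0 => []
  | j + 1 => true :: false :: alternating j

lemma length_alternating (j : ℕ) : (alternating j).length = 2 * j := by
  induction j with
  | zero => rfl
  | succ j ih => simp only [alternating, List.length_cons, ih]; ring

/-- Upper bounds on two consecutive distances, provided that one of two upper bounds on shorter
consecutive distances is expressible. -/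
lemma expressible_and_of_or [NeZero n] {j : ℕ}
    (hor : ∀ {m : ℕ} (x y z : Fin m) (a b : ℕ), 2 * a ≤ 4 ^ j → 2 * b ≤ 4 ^ j →
      Expressible (alternating j) (fun _ (xs : Fin m → Fin n) =>
        (xs y : ℕ) ≤ xs x + a ∨ (xs z : ℕ) ≤ xs y + b))
    {m : ℕ} (x y z : Fin m) (d e : ℕ) (hd : d ≤ 4 ^ j) (he : e ≤ 4 ^ j) :
    Expressible (false :: alternating j) (fun _ (xs : Fin m → Fin n) =>
      (xs y : ℕ) ≤ xs x + d ∧ (xs z : ℕ) ≤ xs y + e) := by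
  have key : ∀ {m : ℕ} (x t y : Fin m) (d : ℕ), d ≤ 4 ^ j →
      Expressible (alternating j) (fun _ (xs : Fin m → Fin n) =>
        (d = 0 ∧ (xs y : ℕ) ≤ xs x) ∨
          (1 ≤ d ∧ ((xs t : ℕ) ≤ xs x + d / 2 ∨ (xs y : ℕ) ≤ xs t + (d - 1 - d / 2)))) := by
    intro m x t y d hd
    rcases Nat.eq_zero_or_pos d with rfl | hpos
    · refine (isAtomic_le y x).expressible.congr fun w xs => ?_
      exact ⟨fun h => h.elim And.right fun h => absurd h.1 (by decide),
        fun h => Or.inl ⟨rfl, h⟩⟩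
    · refine (hor x t y (d / 2) (d - 1 - d / 2) (by omega) (by omega)).congr fun w xs => ?_
      have : d ≠ 0 := by omega
      have h1 : 1 ≤ d := hpos
      simp [this, h1]
  -- A universal position up to `y` tests the first bound, one after `y` the second. A bound `d ≥ 1`
  -- fails iff some point is more than `d / 2` after the left end and more than `d - 1 - d / 2`
  -- before the right end.
  refine ⟨_, Expressible.cases (isAtomic_le (Fin.last m) y.castSucc)
    (key x.castSucc (Fin.last m) y.castSucc d hd)
    (key y.castSucc (Fin.last m) z.castSucc e he), fun w xs => ?_⟩
  simp only [Fin.snoc_castSucc, Fin.snoc_last, Fin.le_def]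
  have hz : (xs z : ℕ) < n := (xs z).isLt
  constructor
  · rintro ⟨h1, h2⟩ a
    omega
  · intro h
    have h1 := h (xs y)
    constructor
    · by_contra! hlt
      have h2 := h ⟨xs x + d / 2 + 1, by omega⟩
      simp only at h2
      omega
    · by_contra! hlt
      have h2 := h ⟨xs y + e / 2 + 1, by omega⟩
      simp only at h2
      omega

/-- Dual to `expressible_and_of_or`: the existential position is a midpoint, and its side of `y`
announces which disjunct is being proved. The two half distances form a conjunction, handled by the
next universal quantifier. -/
lemma expressible_or [NeZero n] (j : ℕ) : ∀ {m : ℕ} (x y z : Fin m) (a b : ℕ),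
    2 * a ≤ 4 ^ j → 2 * b ≤ 4 ^ j →
      Expressible (alternating j) (fun _ (xs : Fin m → Fin n) =>
        (xs y : ℕ) ≤ xs x + a ∨ (xs z : ℕ) ≤ xs y + b) := by
  induction j with
  | zero =>
    intro m x y z a b ha hb
    obtain rfl : a = 0 := by omega
    obtain rfl : b = 0 := by omega
    exact (isAtomic_le y x).or (isAtomic_le z y)
  | succ j ih =>
    intro m x y z a b ha hb
    rw [pow_succ] at ha hb
    refine ⟨_, Expressible.cases (isAtomic_le z.castSucc y.castSucc)
      (isAtomic_const True).expressible
      (Expressible.cases (isAtomic_le (Fin.last m) y.castSucc)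
        (expressible_and_of_or ih x.castSucc (Fin.last m) y.castSucc (a - a / 2) (a / 2)
          (by omega) (by omega))
        (expressible_and_of_or ih y.castSucc (Fin.last m) z.castSucc (b - b / 2) (b / 2)
          (by omega) (by omega))), fun w xs => ?_⟩
    simp only [Fin.snoc_castSucc, Fin.snoc_last, Fin.le_def, and_true]
    have hy := (xs y).2
    have hz := (xs z).2
    constructor
    · intro h
      by_cases hzy : (xs z : ℕ) ≤ xs y
      · exact ⟨xs y, by omega⟩
      · by_cases h1 : (xs y : ℕ) ≤ xs x + a
        · refine ⟨⟨min (xs x + (a - a / 2)) (xs y), by omega⟩, ?_⟩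
          simp only
          omega
        -- Rounding the first half up puts the midpoint strictly after `y`: here `b ≥ 1`, since `y <
        -- z`.
        · refine ⟨⟨min (xs y + (b - b / 2)) (xs z), by omega⟩, ?_⟩
          simp only
          omega
    · rintro ⟨c, hc⟩
      omega

lemma expressible_and [NeZero n] (j : ℕ) {m : ℕ} (x y z : Fin m) (d e : ℕ) (hd : d ≤ 4 ^ j)
    (he : e ≤ 4 ^ j) : Expressible (false :: alternating j) (fun _ (xs : Fin m → Fin n) =>
      (xs y : ℕ) ≤ xs x + d ∧ (xs z : ℕ) ≤ xs y + e) :=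
  expressible_and_of_or (expressible_or j) x y z d e hd he

/-! ### Bits and Boolean functions -/

/-- A given bit of the string. -/
lemma expressible_bit [NeZero n] {j : ℕ} (hj : n ≤ 4 ^ j) (p : Fin n) (b : Bool) :
    Expressible (List.replicate 3 true ++ false :: alternating j)
      (fun w (_ : Fin 0 → Fin n) => w p = b) := by
  have hn : 1 ≤ n := NeZero.one_le
  have hp := p.2
  -- The positions are `min`, the candidate and `max`; the upper bounds `p` and `n - 1 - p` on the
  -- two distances force the candidate to be `p`.
  refine (Expressible.exists_block (m := 3) (Expressible.and_atomic
    (θ := fun w ys => (ys 0 : ℕ) = 0 ∧ (ys 2 : ℕ) = n - 1 ∧ (w (ys 1) = true ↔ b = true)) ?_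
    (expressible_and j 0 1 2 p (n - 1 - p) (by omega) (by omega)))).congr fun w _ => ?_
  · intro w w' xs ys h
    simp only [h.2.1 1, h.2.2.1 0, h.2.2.2 2]
  · constructor
    · intro h
      refine ⟨![⟨0, by omega⟩, p, ⟨n - 1, by omega⟩], ?_⟩
      simp [h]
      omega
    · rintro ⟨ys, ⟨h0, h2, hb⟩, h3, h4⟩
      have : ys 1 = p := Fin.ext (by omega)
      rw [this] at hb
      exact Bool.eq_iff_iff.2 hb

/-- A function with few `1`-inputs: the `1`-input and the position are guessed. -/
lemma expressible_of_card_le [NeZero n] (f : (Fin n → Bool) → Bool) {r j : ℕ} (hr : r ≤ n)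
    (hf : Nat.card {v : Fin n → Bool // f v = true} ≤ r.factorial) (hnr : n ≤ r.factorial)
    (hj : n ≤ 4 ^ j) :
    Expressible (List.replicate r true ++ (List.replicate r false ++
      (List.replicate 3 true ++ false :: alternating j)))
      (fun w (_ : Fin 0 → Fin n) => f w = true) := by
  obtain ⟨e⟩ := Function.Embedding.nonempty_of_card_le
    (α := {v : Fin n → Bool // f v = true}) (β := Equiv.Perm (Fin r))
    (by simpa [Fintype.card_perm, Nat.card_eq_fintype_card] using hf)
  obtain ⟨e'⟩ := Function.Embedding.nonempty_of_card_le
    (α := Fin n) (β := Equiv.Perm (Fin r)) (by simpa [Fintype.card_perm] using hnr)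
  refine (Expressible.exists_index hr e fun v => Expressible.forall_index hr e'
    fun p => expressible_bit hj p (v.1 p)).congr fun w xs => ?_
  constructor
  · exact fun h => ⟨⟨w, h⟩, fun _ => rfl⟩
  · rintro ⟨v, hv⟩
    rw [funext hv]
    exact v.2

/-- Every function of `n` bits: all positions are listed in their order. -/
lemma expressible_trivial (f : (Fin n → Bool) → Bool) :
    Expressible (List.replicate n true) (fun w (_ : Fin 0 → Fin n) => f w = true) := by
  have h : IsAtomic (fun w (ys : Fin n → Fin n) => StrictMono ys ∧ f (w ∘ ys) = true) := by
    intro w w' xs ys h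
    have : w ∘ xs = w' ∘ ys := funext fun i => Bool.eq_iff_iff.2 (h.2.1 i)
    simp only [StrictMono, h.1, this]
  have h' := Expressible.exists_block (qs := []) h
  rw [List.append_nil] at h'
  refine h'.congr fun w _ => ?_
  constructor
  · exact fun h => ⟨id, strictMono_id, h⟩
  · rintro ⟨ys, hys, h⟩
    have : ys = id := by
      have := perm_eq_of_strictMono (ys := ys) (σ := 1)
        (τ := (Equiv.ofBijective ys (Finite.injective_iff_bijective.1 hys.injective)).symm)
        (by simpa using hys)
        (by
          have : ys ∘ (Equiv.ofBijective ys
            (Finite.injective_iff_bijective.1 hys.injective)).symm = id :=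
            funext fun i => Equiv.ofBijective_apply_symm_apply ys _ i
          rw [this]; exact strictMono_id)
      funext i
      have h2 := congrArg (fun σ : Equiv.Perm (Fin n) => σ (ys i)) this
      simpa using h2
    simpa [this] using h

end Expressible

/-! ### From expressibility to formulas -/

section Formula

variable {n : ℕ} [NeZero n] {m : ℕ}

/-- The property `P` is defined by a quantifier-free formula. -/
def QuantifierFree (P : Pred n m) : Prop :=
  ∃ φ : lang.BoundedFormula Empty m, quantifierNumber φ = 0 ∧ ∀ w xs, Holds w φ xs ↔ P w xs

lemma QuantifierFree.imp {P Q : Pred n m} (hP : QuantifierFree P) (hQ : QuantifierFree Q) :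
    QuantifierFree (fun w xs => P w xs → Q w xs) := by
  obtain ⟨φ, hφ, hφ'⟩ := hP
  obtain ⟨ψ, hψ, hψ'⟩ := hQ
  exact ⟨φ.imp ψ, by simp [quantifierNumber, hφ, hψ],
    fun w xs => imp_congr (hφ' w xs) (hψ' w xs)⟩

lemma quantifierFree_false : QuantifierFree (fun _ (_ : Fin m → Fin n) => False) :=
  ⟨.falsum, rfl, fun _ _ => Iff.rfl⟩

lemma QuantifierFree.congr {P Q : Pred n m} (h : QuantifierFree P)
    (hPQ : ∀ w xs, Q w xs ↔ P w xs) : QuantifierFree Q :=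
  Exists.imp (fun _ hφ => ⟨hφ.1, fun w xs => (hφ.2 w xs).trans (hPQ w xs).symm⟩) h

lemma QuantifierFree.not {P : Pred n m} (hP : QuantifierFree P) :
    QuantifierFree (fun w xs => ¬ P w xs) :=
  hP.imp quantifierFree_false

lemma QuantifierFree.or {P Q : Pred n m} (hP : QuantifierFree P) (hQ : QuantifierFree Q) :
    QuantifierFree (fun w xs => P w xs ∨ Q w xs) :=
  (hP.not.imp hQ).congr fun _ _ => or_iff_not_imp_left

lemma QuantifierFree.and_const {P : Pred n m} (hP : QuantifierFree P) (c : Prop) :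
    QuantifierFree (fun w xs => c ∧ P w xs) := by
  by_cases hc : c
  · exact hP.congr fun _ _ => by simp [hc]
  · exact quantifierFree_false.congr fun _ _ => by simp [hc]

lemma QuantifierFree.iff_const {P : Pred n m} (hP : QuantifierFree P) (c : Prop) :
    QuantifierFree (fun w xs => P w xs ↔ c) := by
  by_cases hc : c
  · exact hP.congr fun _ _ => by simp [hc]
  · exact hP.not.congr fun _ _ => by simp [hc]

lemma QuantifierFree.exists {ι : Type*} [Finite ι] {P : ι → Pred n m}
    (hP : ∀ i, QuantifierFree (P i)) : QuantifierFree (fun w xs => ∃ i, P i w xs) := by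
  classical
  have := Fintype.ofFinite ι
  have key : ∀ s : Finset ι, QuantifierFree (fun w xs => ∃ i ∈ s, P i w xs) := by
    intro s
    induction s using Finset.induction_on with
    | empty => exact quantifierFree_false.congr fun _ _ => by simp
    | insert i s _ ih => exact ((hP i).or ih).congr fun _ _ => by simp
  exact (key Finset.univ).congr fun _ _ => by simp

lemma QuantifierFree.forall {ι : Type*} [Finite ι] {P : ι → Pred n m}
    (hP : ∀ i, QuantifierFree (P i)) : QuantifierFree (fun w xs => ∀ i, P i w xs) :=
  (QuantifierFree.exists fun i => (hP i).not).not.congr fun _ _ => by simp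

/-- The atomic properties of a tuple of `m` positions. -/
def atom : (Fin m × Fin m) ⊕ Fin m ⊕ Fin m ⊕ Fin m → Pred n m
  | .inl (i, j) => fun _ xs => xs i < xs j
  | .inr (.inl i) => fun w xs => w (xs i) = true
  | .inr (.inr (.inl i)) => fun _ xs => (xs i : ℕ) = 0
  | .inr (.inr (.inr i)) => fun _ xs => (xs i : ℕ) = n - 1

lemma quantifierFree_atom (k : (Fin m × Fin m) ⊕ Fin m ⊕ Fin m ⊕ Fin m) :
    QuantifierFree (atom (n := n) k) := by
  rcases k with ⟨i, j⟩ | i | i | i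
  · exact ⟨.rel (L := lang) (l := 2) Rel.lt ![.var (.inr i), .var (.inr j)], rfl,
      fun _ _ => Iff.rfl⟩
  · exact ⟨.rel (L := lang) (l := 1) Rel.S ![.var (.inr i)], rfl, fun _ _ => Iff.rfl⟩
  · exact ⟨.equal (.var (.inr i)) (.func (L := lang) (l := 0) Func.min ![]), rfl,
      fun _ _ => Fin.ext_iff⟩
  · exact ⟨.equal (.var (.inr i)) (.func (L := lang) (l := 0) Func.max ![]), rfl,
      fun _ _ => Fin.ext_iff⟩

/-- There are finitely many atomic types `τ`; the formula is the disjunction of those realised by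
some pair that satisfies `P`. -/
lemma IsAtomic.quantifierFree {P : Pred n m} (h : IsAtomic P) : QuantifierFree P := by
  refine (QuantifierFree.exists
    (ι := (Fin m × Fin m) ⊕ Fin m ⊕ Fin m ⊕ Fin m → Prop)
    (P := fun τ w xs => (∃ w' ys, P w' ys ∧ ∀ k, atom k w' ys ↔ τ k) ∧ ∀ k, atom k w xs ↔ τ k)
    fun τ => (QuantifierFree.forall fun k =>
      (quantifierFree_atom k).iff_const (τ k)).and_const _).congr fun w xs => ?_
  constructor
  · exact fun hP => ⟨fun k => atom k w xs, ⟨w, xs, hP, fun _ => Iff.rfl⟩, fun _ => Iff.rfl⟩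
  · rintro ⟨τ, ⟨w', ys, hP, hys⟩, hxs⟩
    have heq : ∀ k, atom k w xs ↔ atom k w' ys := fun k => (hxs k).trans (hys k).symm
    refine (h w w' xs ys ⟨fun i j => heq (.inl (i, j)), fun i => heq (.inr (.inl i)),
      fun i => heq (.inr (.inr (.inl i))), fun i => heq (.inr (.inr (.inr i)))⟩).2 hP

lemma Expressible.exists_formula {qs : List Bool} : ∀ {m : ℕ} {P : Pred n m}
    (_ : Expressible qs P), ∃ φ : lang.BoundedFormula Empty m,
      quantifierNumber φ = qs.length ∧ ∀ w xs, Holds w φ xs ↔ P w xs := by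
  induction qs with
  | nil => exact fun h => IsAtomic.quantifierFree h
  | cons q qs ih =>
    intro m P h
    cases q
    all_goals
      obtain ⟨P', hP', hP⟩ := h
      obtain ⟨φ, hφ, hφ'⟩ := ih hP'
    · refine ⟨φ.all, by simp [quantifierNumber, hφ], fun w xs => ?_⟩
      rw [hP]
      exact forall_congr' fun a => hφ' w _
    · refine ⟨(φ.imp .falsum).all.imp .falsum, by simp [quantifierNumber, hφ], fun w xs => ?_⟩
      rw [hP, ← not_forall_not]
      exact not_congr (forall_congr' fun a => not_congr (hφ' w _))

lemma Expressible.exists_sentence {qs : List Bool} {f : (Fin n → Bool) → Bool}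
    (h : Expressible qs (fun w (_ : Fin 0 → Fin n) => f w = true)) :
    ∃ φ : lang.Sentence, Defines φ f ∧ quantifierNumber φ = qs.length := by
  obtain ⟨φ, hφ, hφ'⟩ := h.exists_formula
  refine ⟨φ, ⟨fun w hw => ?_, fun w hw hs => ?_⟩, hφ⟩
  · exact (satisfies_iff_holds (xs := Fin.elim0) w φ).2 ((hφ' w _).2 hw)
  · have := (hφ' w _).1 ((satisfies_iff_holds (xs := Fin.elim0) w φ).1 hs)
    simp only [Set.mem_ofPred_eq] at hw
    simp [hw] at this

end Formula

/-! ### The number of quantifiers -/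

/-- Beyond `M`, each new factor of the factorial exceeds `M`. -/
lemma pow_le_pow_mul_factorial (M r : ℕ) : M ^ r ≤ M ^ M * r.factorial := by
  rcases Nat.eq_zero_or_pos M with rfl | hM
  · rcases r with _ | r <;> simp
  induction r with
  | zero => simpa using Nat.one_le_pow _ _ hM
  | succ r ih =>
    rcases le_or_gt (r + 1) M with h | h
    · exact (Nat.pow_le_pow_right hM h).trans (Nat.le_mul_of_pos_right _ (Nat.factorial_pos _))
    · rw [pow_succ, Nat.factorial_succ]
      calc M ^ r * M ≤ (M ^ M * r.factorial) * (r + 1) := Nat.mul_le_mul ih (by omega)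
        _ = _ := by ring

/-- The factorial of a number that is a small multiple of `log n` exceeds a power of `n`. -/
lemma exists_factorial_ge {ε : ℝ} (hε : 0 < ε) (A k : ℕ) : ∃ D : ℝ, 0 ≤ D ∧ ∀ n : ℕ, 1 ≤ n →
    ∃ r : ℕ, (A + 1) * n ^ k ≤ r.factorial ∧ (r : ℝ) ≤ ε * Real.logb 2 n + D := by
  obtain ⟨s, hs⟩ := exists_nat_ge ((k : ℝ) / ε)
  -- With base `2 ^ S`, about `(k / S) log n ≤ ε log n` factors suffice to reach `n ^ k`.
  set S : ℕ := s + 1 with hS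
  have hSpos : (0 : ℝ) < S := by positivity
  have hkS : (k : ℝ) / S ≤ ε := by
    rw [div_le_iff₀ hSpos]
    rw [div_le_iff₀ hε] at hs
    push_cast [hS]
    nlinarith
  set c : ℕ := (2 ^ S) ^ 2 ^ S with hc
  have hcpos : 0 < c := by positivity
  set K : ℝ := Real.logb 2 (((A + 1) * c : ℕ) : ℝ) with hK
  have hK0 : 0 ≤ K := Real.logb_nonneg (by norm_num) (by
    have : 1 ≤ (A + 1) * c := Nat.one_le_iff_ne_zero.2 (by positivity)
    exact_mod_cast this)
  refine ⟨K / S + 1, by positivity, fun n hn => ?_⟩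
  have hn' : (1 : ℝ) ≤ n := by exact_mod_cast hn
  have hlog : 0 ≤ Real.logb 2 n := Real.logb_nonneg (by norm_num) hn'
  set X : ℝ := (K + k * Real.logb 2 n) / S with hX
  have hX0 : 0 ≤ X := by positivity
  refine ⟨⌈X⌉₊, ?_, ?_⟩
  · have h1 : (((A + 1) * c * n ^ k : ℕ) : ℝ) ≤ (((2 ^ S) ^ ⌈X⌉₊ : ℕ) : ℝ) := by
      have e1 : Real.logb 2 (((A + 1) * c * n ^ k : ℕ) : ℝ) = K + k * Real.logb 2 n := by
        rw [Nat.cast_mul, Real.logb_mul (by positivity) (by positivity), Nat.cast_pow,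
          Real.logb_pow]
      have e2 : (((2 ^ S) ^ ⌈X⌉₊ : ℕ) : ℝ) = (2 : ℝ) ^ ((S * ⌈X⌉₊ : ℕ) : ℝ) := by
        rw [Real.rpow_natCast, ← pow_mul]
        push_cast
        rfl
      rw [e2, ← Real.logb_le_iff_le_rpow (by norm_num) (by positivity), e1]
      have := Nat.le_ceil X
      rw [hX, div_le_iff₀ hSpos] at this
      push_cast
      rw [hX]
      linarith
    have h2 : (A + 1) * c * n ^ k ≤ c * (⌈X⌉₊).factorial :=
      (Nat.cast_le.1 h1).trans (pow_le_pow_mul_factorial _ _)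
    refine Nat.le_of_mul_le_mul_left (c := c) ?_ hcpos
    calc c * ((A + 1) * n ^ k) = (A + 1) * c * n ^ k := by ring
      _ ≤ _ := h2
  · have h1 := (Nat.ceil_lt_add_one hX0).le
    have h2 : X = K / S + k / S * Real.logb 2 n := by rw [hX]; ring
    have h3 := mul_le_mul_of_nonneg_right hkS hlog
    linarith

lemma logb_two_le (n : ℕ) (hn : 1 ≤ n) : Real.logb 2 n ≤ n := by
  rw [Real.logb_le_iff_le_rpow (by norm_num) (by exact_mod_cast hn), Real.rpow_natCast]
  exact_mod_cast Nat.lt_two_pow_self.le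

lemma two_mul_log_four_le (n : ℕ) (hn : 1 ≤ n) : (2 * Nat.log 4 n : ℝ) ≤ Real.logb 2 n := by
  rw [Real.le_logb_iff_rpow_le (by norm_num) (by exact_mod_cast hn)]
  have h : 4 ^ Nat.log 4 n ≤ n := Nat.pow_log_le_self 4 (by omega)
  have e : (2 : ℝ) ^ (2 * Nat.log 4 n : ℝ) = ((4 ^ Nat.log 4 n : ℕ) : ℝ) := by
    rw [show (2 * Nat.log 4 n : ℝ) = ((2 * Nat.log 4 n : ℕ) : ℝ) by push_cast; rfl,
      Real.rpow_natCast, pow_mul]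
    norm_num
  rw [e]
  exact_mod_cast h

theorem exists_sentence_of_onesBoundedBy {ε : ℝ} (hε : 0 < ε) (C k : ℕ) : ∃ D : ℝ,
    ∀ F : Family, F.OnesBoundedBy C k → ∀ (n : ℕ) [NeZero n], ∃ φ : lang.Sentence,
      Defines φ (F n) ∧ (quantifierNumber φ : ℝ) ≤ (1 + ε) * Real.logb 2 n + D := by
  -- Half of `ε` for each of the two guesses; the cap `1 / 2` is for the case `r > n`. The exponent
  -- `k + 1` lets `r!` bound both `C * n ^ k` and `n`.
  obtain ⟨D, hD0, hD⟩ := exists_factorial_ge (ε := min (ε / 2) (1 / 2)) (by positivity) C (k + 1)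
  refine ⟨2 * D + 6, fun F hF n _ => ?_⟩
  have hn : 1 ≤ n := NeZero.one_le
  have hlog : 0 ≤ Real.logb 2 n := Real.logb_nonneg (by norm_num) (by exact_mod_cast hn)
  obtain ⟨r, hr, hrD⟩ := hD n hn
  have h1 : min (ε / 2) (1 / 2) * Real.logb 2 n ≤ ε / 2 * Real.logb 2 n :=
    mul_le_mul_of_nonneg_right (min_le_left _ _) hlog
  have h2 : min (ε / 2) (1 / 2) * Real.logb 2 n ≤ 1 / 2 * Real.logb 2 n :=
    mul_le_mul_of_nonneg_right (min_le_right _ _) hlog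
  have h3 := logb_two_le n hn
  rcases le_or_gt r n with hrn | hrn
  · have hpow : 1 ≤ n ^ k := Nat.one_le_pow _ _ hn
    have hcard : Nat.card {v : Fin n → Bool // F n v = true} ≤ r.factorial := by
      refine (hF n hn).trans (le_trans ?_ hr)
      exact Nat.mul_le_mul (Nat.le_succ C) (Nat.pow_le_pow_right hn (Nat.le_succ k))
    have hnr : n ≤ r.factorial := by
      refine le_trans ?_ hr
      calc n = 1 * (1 * n) := by ring
        _ ≤ (C + 1) * (n ^ k * n) :=
          Nat.mul_le_mul (by omega) (Nat.mul_le_mul_right n hpow)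
        _ = (C + 1) * n ^ (k + 1) := by rw [pow_succ]
    obtain ⟨φ, hφ, hφ'⟩ := (expressible_of_card_le (F n) (j := Nat.log 4 n + 1) hrn hcard hnr
      (Nat.lt_pow_succ_log_self (by norm_num) n).le).exists_sentence
    refine ⟨φ, hφ, ?_⟩
    have h4 := two_mul_log_four_le n hn
    rw [hφ']
    simp only [List.length_append, List.length_replicate, List.length_cons, length_alternating]
    push_cast
    linarith
  -- Here `n < r ≤ n / 2 + D`, so `n < 2 * D` and listing all positions costs only a constant.
  · obtain ⟨φ, hφ, hφ'⟩ := (expressible_trivial (F n)).exists_sentence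
    refine ⟨φ, hφ, ?_⟩
    rw [hφ', List.length_replicate]
    have h4 : (n : ℝ) < r := by exact_mod_cast hrn
    have h5 : 0 ≤ (1 + ε) * Real.logb 2 n := by positivity
    linarith

end BinString

theorem theoremB :
    (∀ ε : ℝ, 0 < ε → ∀ C k : ℕ, ∃ D : ℝ, ∀ F : BinString.Family, F.OnesBoundedBy C k →
      ∀ (n : ℕ) [NeZero n], ∃ φ : BinString.lang.Sentence,
        BinString.Defines φ (F n) ∧
          (BinString.quantifierNumber φ : ℝ) ≤ (1 + ε) * Real.logb 2 n + D) ∧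
    (∃ F : BinString.Family, F.IsSparse ∧
      ∃ N : ℕ, ∀ (n : ℕ) [NeZero n], N ≤ n → ∀ φ : BinString.lang.Sentence,
        BinString.Defines φ (F n) →
          ⌊Real.logb 2 n⌋₊ ≤ BinString.quantifierNumber φ) := by
  refine ⟨fun ε hε C k => BinString.exists_sentence_of_onesBoundedBy hε C k,
    BinString.middleFamily, BinString.middleFamily_isSparse, 4, fun n _ hn φ hφ => ?_⟩
  have h := Real.natFloor_logb_natCast 2 n
  rw [Nat.cast_ofNat] at h
  rw [h]
  exact BinString.log_le_quantifierNumber n hn φ hφ
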